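/- For a finite group $G$ and $S\subseteq G$, let $\mathrm{Cay}(G,S)$ be the digraph with vertex set $G$ in which $(g,h)$ is an arc if and only if $gh^{-1}\in S$. Its automorphism group, consisting of the permutations $f$ of $G$ such that $(f(g),f(h))$ is an arc if and only if $(g,h)$ is an arc, contains all right multiplications $x\mapsto xa$ with $a\in G$. The digraph $\mathrm{Cay}(G,S)$ is called a DRR (digraphical regular representation) if its automorphism group consists of these right multiplications only. For every real number $\varepsilon>0$ there exists a natural number $n_\varepsilon$ such that, for every finite abelian group $A$ of order at least $n_\varepsilon$ and for every subgroup $B$ of $A$ of index $2$, $$\frac{|\{S\mid S\subseteq A\setminus B,\ \mathrm{Cay}(A,S)\text{ is a DRR}\}|}{|\{S\mid S\subseteq A\setminus B\}|}\ \ge\ 1-\varepsilon .$$ -/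

import Mathlib

namespace CayleyDRR

/-- The Cayley digraph `Cay(G, S)`: vertex set `G`, with an arc `(g, h)` iff `g * h⁻¹ ∈ S`. -/
def cayleyDigraph {G : Type*} [Group G] (S : Set G) : Digraph G where
  Adj g h := g * h⁻¹ ∈ S

/-- The automorphism group of a digraph: the permutations of the vertex set that preserve arcs
and non-arcs. -/
def autGroup {V : Type*} (Γ : Digraph V) : Subgroup (Equiv.Perm V) where
  carrier := {f | ∀ u v, Γ.Adj (f u) (f v) ↔ Γ.Adj u v}
  one_mem' := fun _ _ => Iff.rfl
  mul_mem' := fun {f g} hf hg u v => (hf (g u) (g v)).trans (hg u v)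
  inv_mem' := fun {f} hf u v => by
    have h := hf (f⁻¹ u) (f⁻¹ v)
    simpa using h.symm

/-- The right regular representation of `G`: the group of all permutations `x ↦ x * g`. -/
def rightRegular (G : Type*) [Group G] : Subgroup (Equiv.Perm G) where
  carrier := Set.range (fun g : G => Equiv.mulRight g)
  one_mem' := ⟨1, Equiv.mulRight_one⟩
  mul_mem' := by
    rintro _ _ ⟨a, rfl⟩ ⟨b, rfl⟩
    exact ⟨b * a, Equiv.mulRight_mul b a⟩
  inv_mem' := by
    rintro _ ⟨a, rfl⟩
    exact ⟨a⁻¹, (Equiv.inv_mulRight a).symm⟩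

/-- `Cay(G, S)` is a DRR (digraphical regular representation): its automorphism group is `G`,
identified with its right regular representation. -/
def IsDRR {G : Type*} [Group G] (S : Set G) : Prop :=
  autGroup (cayleyDigraph S) = rightRegular G

end CayleyDRR

namespace CayleyDRR

/-! If `S` is not a DRR, take a minimal group `H` with `A < H ≤ Aut Cay(A, S)`, where `A` acts by
translation. Then `A` is an abelian maximal subgroup of `H`, complemented by the stabiliser `P` of
`1`. If `A` is normal in `H`, a nontrivial element of `P` is a group automorphism of `A` preserving
`S`. Otherwise `A` meets its other conjugates in `Z(H)`, and transfer shows that `P Z(H)` is normal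
(`conj_mem_mul_center`). Put `K = Z(H) ≤ L = N_A(P) < A`: for each `x ∉ L` some element of `P` acts
on `xK` as translation by a nontrivial `κ ∈ K`, so `S ∩ xK` is invariant under `κ`
(`exists_automorphism_or_central_subgroup`).

Each given automorphism or pair `(K, L)` accounts for at most a fraction `decay ^ (|A| / 4)` of the
subsets of `A \ B`, because at least half of `A \ B` lies outside any proper subgroup. There are
only `exp(O(log² |A|))` automorphisms and pairs, so a union bound finishes the proof. -/

/-! ### Abelian maximal subgroups and transfer -/

/-- The centraliser of `a` contains `A`, so it is `A` or `G`. It also contains `g A g⁻¹`; were it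
`A`, then `g` would normalise `A`, which is self-normalising. -/
theorem mem_center_of_conj_mem {G : Type*} [Group G] [Finite G] {A : Subgroup G} (hA : IsCoatom A)
    (hc : ∀ a ∈ A, ∀ b ∈ A, a * b = b * a) (hn : ¬ A.Normal) {g a : G} (hg : g ∉ A)
    (ha : a ∈ A) (hga : g⁻¹ * a * g ∈ A) : a ∈ Subgroup.center G := by
  have hle : A ≤ Subgroup.centralizer {a} := fun b hb => by
    rw [Subgroup.mem_centralizer_singleton_iff]
    exact hc b hb a ha
  rcases hA.le_iff.1 hle with h | h
  · rw [Subgroup.mem_center_iff]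
    intro b
    have : b ∈ Subgroup.centralizer {a} := h ▸ Subgroup.mem_top b
    rwa [Subgroup.mem_centralizer_singleton_iff] at this
  · exfalso
    have hnorm : Subgroup.normalizer (A : Set G) = A := by
      rcases hA.le_iff.1 (Subgroup.le_normalizer (H := A)) with h' | h'
      · exact absurd (Subgroup.normalizer_eq_top_iff.1 h') hn
      · exact h'
    refine hg (hnorm ▸ Subgroup.mem_normalizer_fintype fun n hn' => ?_)
    have : g * n * g⁻¹ ∈ Subgroup.centralizer {a} := by
      rw [Subgroup.mem_centralizer_singleton_iff]
      have := hc n hn' _ hga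
      calc g * n * g⁻¹ * a = g * (n * (g⁻¹ * a * g)) * g⁻¹ := by group
        _ = g * ((g⁻¹ * a * g) * n) * g⁻¹ := by rw [this]
        _ = a * (g * n * g⁻¹) := by group
    rwa [h] at this

theorem center_le_of_isCoatom {G : Type*} [Group G] {A : Subgroup G} (hA : IsCoatom A) (hn : ¬ A.Normal) :
    Subgroup.center G ≤ A := by
  have hle : Subgroup.center G ≤ Subgroup.normalizer (A : Set G) := fun z hz => by
    rw [Subgroup.mem_center_iff] at hz
    rw [Subgroup.mem_normalizer_iff]
    intro h
    rw [← hz h, mul_inv_cancel_right]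
  rcases hA.le_iff.1 (Subgroup.le_normalizer (H := A)) with h | h
  · exact absurd (Subgroup.normalizer_eq_top_iff.1 h) hn
  · exact h ▸ hle

/-- Left multiplication by `a` on `G ⧸ A` has order dividing `q` and fixes only the trivial coset,
so the index is `1` modulo `q`. -/
theorem not_dvd_index_of_pow_mem_center {G : Type*} [Group G] [Finite G] {A : Subgroup G}
    (hconj : ∀ g a : G, g ∉ A → a ∈ A → g⁻¹ * a * g ∈ A → a ∈ Subgroup.center G)
    {q : ℕ} (hq : q.Prime) {a : G} (ha : a ∈ A) (haz : a ∉ Subgroup.center G)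
    (haq : a ^ q ∈ Subgroup.center G) : ¬ q ∣ A.index := by
  classical
  have := Fact.mk hq
  have := Fintype.ofFinite (G ⧸ A)
  let f : Function.End (G ⧸ A) := MulAction.toEndHom a
  have hf : f ^ q ^ 1 = 1 := by
    rw [pow_one, ← map_pow]
    funext x
    induction x using QuotientGroup.induction_on with
    | H g =>
      change ((a ^ q * g : G) : G ⧸ A) = (g : G ⧸ A)
      rw [← Subgroup.mem_center_iff.1 haq g, QuotientGroup.mk_mul_of_mem]
      exact A.pow_mem ha q
  have hmod := Equiv.Perm.card_fixedPoints_modEq hf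
  have hfix : ∀ x : G ⧸ A, f x = x ↔ x = ((1 : G) : G ⧸ A) := by
    intro x
    induction x using QuotientGroup.induction_on with
    | H g =>
      change ((a * g : G) : G ⧸ A) = (g : G ⧸ A) ↔ _
      rw [eq_comm, QuotientGroup.eq, eq_comm, QuotientGroup.eq, inv_one, one_mul, ← mul_assoc]
      refine ⟨fun h => by_contra fun hg => haz (hconj g a hg ha h), fun h => ?_⟩
      exact A.mul_mem (A.mul_mem (A.inv_mem h) ha) h
  have hone : Nat.card (Function.fixedPoints f) = 1 := by
    rw [Nat.card_eq_one_iff_exists]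
    exact ⟨⟨((1 : G) : G ⧸ A), (hfix _).2 rfl⟩, fun y => Subtype.ext ((hfix _).1 y.2)⟩
  simp only [Fintype.card_eq_nat_card, hone] at hmod
  intro hdvd
  rw [Subgroup.index] at hdvd
  have h1 : (1 : ℕ) ≡ 0 [MOD q] := hmod.symm.trans (Nat.modEq_zero_iff_dvd.2 hdvd)
  exact hq.one_lt.ne' (Nat.dvd_one.1 (Nat.modEq_zero_iff_dvd.1 h1))

/-- A complement `P` of an abelian subgroup that meets its conjugates in the centre is normal
modulo the centre: `P × Z(G)` is the kernel of a transfer map. -/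
theorem conj_mem_mul_center {G : Type*} [Group G] [Finite G] {α : Type*} [CommGroup α] (ρ : α →* G)
    (hρ : Function.Injective ρ) (P : Subgroup G) (hP : Subgroup.IsComplement' P ρ.range)
    (hz : Subgroup.center G ≤ ρ.range)
    (hconj : ∀ g a : G, g ∉ ρ.range → a ∈ ρ.range → g⁻¹ * a * g ∈ ρ.range →
      a ∈ Subgroup.center G)
    {p : G} (hp : p ∈ P) (g : G) :
    ∃ p' ∈ P, ∃ z ∈ Subgroup.center G, g⁻¹ * p * g = p' * z := by
  classical
  set A := ρ.range with hAdef
  set K : Subgroup α := (Subgroup.center G).comap ρ with hK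
  have : Finite α := Finite.of_injective ρ hρ
  let e : α ≃* A := MonoidHom.ofInjective hρ
  let φ : A →* α ⧸ K := (QuotientGroup.mk' K).comp e.symm.toMonoidHom
  have he : ∀ x, ((e x : A) : G) = ρ x := fun x => rfl
  have hφ : ∀ x : α, φ (e x) = (x : α ⧸ K) := fun x => by simp [φ]
  let τ : G →* α ⧸ K := φ.transfer
  have hidx : P.index = Nat.card A ∧ A.index = Nat.card P :=
    ⟨hP.symm.index_eq_card, hP.index_eq_card⟩
  -- Each factor of the transfer is a conjugate `g₀⁻¹ (ρ x)^k g₀` lying in `A`. Either `g₀ ∈ A` or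
  -- `(ρ x)^k` is central, so conjugation changes nothing.
  have hτ : ∀ x : α, τ (ρ x) = (x : α ⧸ K) ^ A.index := by
    intro x
    have key := MonoidHom.transfer_eq_pow φ (ρ x) (by
      intro k g₀ h
      have hxk : ρ x ^ k ∈ A := ⟨x ^ k, map_pow _ _ _⟩
      by_cases hg : g₀ ∈ A
      · obtain ⟨y, rfl⟩ := hg
        rw [← map_pow, ← map_inv, ← map_mul, ← map_mul, mul_right_comm, inv_mul_cancel, one_mul]
      · have := Subgroup.mem_center_iff.1 (hconj _ _ hg hxk h) g₀
        rw [mul_assoc, ← this, inv_mul_cancel_left])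
    rw [show τ (ρ x) = φ.transfer (ρ x) from rfl, key, ← QuotientGroup.mk_pow, ← hφ]
    congr 1
    apply Subtype.ext
    simp [he]
  have hcop : Nat.Coprime A.index (Nat.card (α ⧸ K)) := by
    refine Nat.Coprime.symm (Nat.coprime_of_dvd fun q hq hqQ => ?_)
    have := Fact.mk hq
    obtain ⟨y, hy⟩ := exists_prime_orderOf_dvd_card' q hqQ
    induction y using QuotientGroup.induction_on with
    | H x =>
      refine not_dvd_index_of_pow_mem_center hconj hq (a := ρ x) ⟨x, rfl⟩ ?_ ?_
      · intro hx
        rw [(QuotientGroup.eq_one_iff x).2 hx, orderOf_one] at hy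
        exact hq.one_lt.ne hy
      · rw [← map_pow]
        have := pow_orderOf_eq_one (x : α ⧸ K)
        rw [hy, ← QuotientGroup.mk_pow, QuotientGroup.eq_one_iff] at this
        exact this
  have hpow : Function.Bijective (fun y : α ⧸ K => y ^ A.index) :=
    (powCoprime hcop.symm).bijective
  have hsurj : Function.Surjective τ := by
    intro y
    obtain ⟨y', rfl⟩ := hpow.2 y
    obtain ⟨x, rfl⟩ := QuotientGroup.mk_surjective y'
    exact ⟨ρ x, hτ x⟩
  -- `|P|` is the index of `A`, coprime to the order of the target.
  have hPker : P ≤ τ.ker := by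
    intro p hp
    rw [MonoidHom.mem_ker, ← orderOf_eq_one_iff]
    refine Nat.eq_one_of_dvd_coprimes hcop ?_ (orderOf_dvd_natCard _)
    rw [hidx.2]
    exact (orderOf_map_dvd τ p).trans (P.orderOf_dvd_natCard hp)
  have hZker : Subgroup.center G ≤ τ.ker := by
    intro z hzz
    obtain ⟨x, rfl⟩ := hz hzz
    rw [MonoidHom.mem_ker, hτ, (QuotientGroup.eq_one_iff x).2 hzz, one_pow]
  have hcard : Nat.card τ.ker = Nat.card P * Nat.card (Subgroup.center G) := by
    have h1 : Nat.card τ.ker * Nat.card (α ⧸ K) = Nat.card G := by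
      rw [← τ.ker.card_mul_index, Subgroup.index_ker, MonoidHom.range_eq_top.2 hsurj,
        Subgroup.card_top]
    have h2 : Nat.card P * Nat.card A = Nat.card G := by rw [← hidx.1, P.card_mul_index]
    have h3 : Nat.card A = Nat.card (α ⧸ K) * Nat.card (Subgroup.center G) := by
      rw [← Nat.card_congr e.toEquiv, K.card_eq_card_quotient_mul_card_subgroup]
      congr 1
      refine Nat.card_congr (Equiv.ofBijective (fun k : K => ⟨ρ k, k.2⟩) ⟨?_, ?_⟩)
      · intro k k' h
        exact Subtype.ext (hρ (congrArg Subtype.val h))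
      · rintro ⟨z, hzz⟩
        obtain ⟨x, rfl⟩ := hz hzz
        exact ⟨⟨x, hzz⟩, rfl⟩
    have hpos : 0 < Nat.card (α ⧸ K) := Nat.card_pos
    apply Nat.eq_of_mul_eq_mul_right hpos
    rw [h1, ← h2, h3]
    ring
  -- Equal cardinalities turn the injective product map into a bijection, so the normal subgroup
  -- `τ.ker` is exactly `P Z(G)`.
  let m : P × Subgroup.center G → τ.ker := fun x =>
    ⟨x.1 * x.2, τ.ker.mul_mem (hPker x.1.2) (hZker x.2.2)⟩
  have hm : Function.Bijective m := by
    rw [Nat.bijective_iff_injective_and_card]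
    refine ⟨?_, by rw [hcard, Nat.card_prod]⟩
    rintro ⟨a, z⟩ ⟨b, w⟩ h
    have h' : (a : G) * z = b * w := congrArg Subtype.val h
    have := @hP.1 (a, ⟨z, hz z.2⟩) (b, ⟨w, hz w.2⟩) h'
    simp only [Prod.mk.injEq, Subtype.mk.injEq] at this
    exact Prod.ext this.1 (Subtype.ext this.2)
  have hmem : g⁻¹ * p * g ∈ τ.ker := by
    have := (inferInstance : τ.ker.Normal).conj_mem p (hPker hp) g⁻¹
    rwa [inv_inv] at this
  obtain ⟨⟨p', z⟩, h⟩ := hm.2 ⟨_, hmem⟩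
  exact ⟨p', p'.2, z, z.2, (congrArg Subtype.val h).symm⟩

/-! ### Minimal overgroups of the regular representation -/

/-- The action of a commutative group on itself by right multiplication. -/
def mulRightHom (α : Type*) [CommGroup α] : α →* Equiv.Perm α where
  toFun := Equiv.mulRight
  map_one' := Equiv.mulRight_one
  map_mul' a b := by rw [mul_comm, Equiv.mulRight_mul]

theorem exists_automorphism_or_central_subgroup {α : Type*} [CommGroup α] [Finite α]
    {H : Subgroup (Equiv.Perm α)} (hlt : rightRegular α < H)
    (hmin : ∀ H' : Subgroup (Equiv.Perm α), rightRegular α < H' → H' ≤ H → H' = H) :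
    (∃ φ : α ≃* α, φ ≠ 1 ∧ φ.toEquiv ∈ H) ∨
    ∃ K L : Subgroup α, K ≤ L ∧ L ≠ ⊤ ∧ ∀ x ∉ L, ∃ p ∈ H, p 1 = 1 ∧ ∃ κ ∈ K, κ ≠ 1 ∧
      ∀ k ∈ K, p (x * k) = x * k * κ := by
  classical
  have hmem : ∀ x : α, mulRightHom α x ∈ H := fun x => hlt.le ⟨x, rfl⟩
  let ρ : α →* H := (mulRightHom α).codRestrict H hmem
  have hρa : ∀ x y : α, (ρ x : Equiv.Perm α) y = y * x := fun x y => rfl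
  have hρ : Function.Injective ρ := by
    intro x y h
    have := hρa x 1
    rw [h, hρa] at this
    simpa using this.symm
  have hmap : ρ.range.map H.subtype = rightRegular α := by
    ext f
    constructor
    · rintro ⟨_, ⟨x, rfl⟩, rfl⟩
      exact ⟨x, rfl⟩
    · rintro ⟨x, rfl⟩
      exact ⟨ρ x, ⟨x, rfl⟩, rfl⟩
  have hcoatom : IsCoatom ρ.range := by
    constructor
    · intro h
      rw [h, ← MonoidHom.range_eq_map, Subgroup.range_subtype] at hmap
      exact hlt.ne hmap.symm
    · intro M hM
      have h1 : rightRegular α < M.map H.subtype := by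
        rw [← hmap]
        exact (Subgroup.map_lt_map_iff_of_injective H.subtype_injective).2 hM
      have h2 := hmin _ h1 (Subgroup.map_subtype_le M)
      apply Subgroup.map_injective H.subtype_injective
      rw [h2, ← MonoidHom.range_eq_map, Subgroup.range_subtype]
  let P : Subgroup H :=
    { carrier := {p | (p : Equiv.Perm α) 1 = 1}
      one_mem' := rfl
      mul_mem' := fun {p q} hp hq => by
        change (p : Equiv.Perm α) ((q : Equiv.Perm α) 1) = 1
        rw [show (q : Equiv.Perm α) 1 = 1 from hq, show (p : Equiv.Perm α) 1 = 1 from hp]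
      inv_mem' := fun {p} hp => by
        change (p : Equiv.Perm α)⁻¹ 1 = 1
        rw [Equiv.Perm.inv_eq_iff_eq]
        exact (show (p : Equiv.Perm α) 1 = 1 from hp).symm }
  have hPmem : ∀ p : H, p ∈ P ↔ (p : Equiv.Perm α) 1 = 1 := fun p => Iff.rfl
  have hdecomp : ∀ h : H, (ρ ((h : Equiv.Perm α) 1))⁻¹ * h ∈ P := by
    intro h
    rw [hPmem]
    change (ρ ((h : Equiv.Perm α) 1) : Equiv.Perm α)⁻¹ ((h : Equiv.Perm α) 1) = 1
    rw [Equiv.Perm.inv_eq_iff_eq, hρa, one_mul]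
  have hconjP : ∀ (x : α) (p : H), (ρ x)⁻¹ * p * ρ x ∈ P ↔ (p : Equiv.Perm α) x = x := by
    intro x p
    rw [hPmem]
    change (ρ x : Equiv.Perm α)⁻¹ ((p : Equiv.Perm α) ((ρ x : Equiv.Perm α) 1)) = 1 ↔ _
    rw [Equiv.Perm.inv_eq_iff_eq, hρa, one_mul]
  have hPne : ∃ p ∈ P, p ≠ 1 := by
    by_contra! hcon
    refine hcoatom.1 ((Subgroup.eq_top_iff' _).2 fun h => ?_)
    have := hcon _ (hdecomp h)
    rw [inv_mul_eq_one] at this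
    exact ⟨_, this⟩
  by_cases hn : ρ.range.Normal
  · left
    obtain ⟨p, hp, hp1⟩ := hPne
    rw [hPmem] at hp
    have hmul : ∀ x y, (p : Equiv.Perm α) (x * y) =
        (p : Equiv.Perm α) x * (p : Equiv.Perm α) y := by
      intro x y
      obtain ⟨z, hz⟩ := hn.conj_mem (ρ y) ⟨y, rfl⟩ p
      have h1 : ∀ w, (p : Equiv.Perm α) (w * y) = (p : Equiv.Perm α) w * z := by
        intro w
        have h2 : ρ z * p = p * ρ y := by rw [hz, inv_mul_cancel_right]
        exact (congrArg (fun f : H => (f : Equiv.Perm α) w) h2).symm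
      have h3 := h1 1
      rw [one_mul, hp, one_mul] at h3
      rw [h1, h3]
    refine ⟨MulEquiv.mk' p hmul, fun h => hp1 ?_, p.2⟩
    apply Subtype.ext
    ext x
    exact DFunLike.congr_fun h x
  · right
    have hc : ∀ a ∈ ρ.range, ∀ b ∈ ρ.range, a * b = b * a := by
      rintro _ ⟨x, rfl⟩ _ ⟨y, rfl⟩
      rw [← map_mul, mul_comm, map_mul]
    have hz := center_le_of_isCoatom hcoatom hn
    have hcompl : Subgroup.IsComplement' P ρ.range := by
      refine Subgroup.IsComplement'.symm
        (Subgroup.isComplement'_of_disjoint_and_mul_eq_univ ?_ ?_)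
      · rw [Subgroup.disjoint_def]
        rintro _ ⟨x, rfl⟩ hx
        rw [hPmem, hρa, one_mul] at hx
        rw [hx, map_one]
      · refine Set.eq_univ_of_forall fun h => ?_
        exact ⟨_, ⟨_, rfl⟩, _, hdecomp h, mul_inv_cancel_left _ _⟩
    -- `K` is the centre of `H` and `L` the normaliser of the point stabiliser `P`, both pulled back
    -- to `α`.
    refine ⟨(Subgroup.center H).comap ρ, (Subgroup.normalizer (P : Set H)).comap ρ, ?_, ?_, ?_⟩
    · refine Subgroup.comap_mono fun z hz => ?_
      rw [Subgroup.mem_center_iff] at hz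
      rw [Subgroup.mem_normalizer_iff]
      intro h
      rw [← hz h, mul_inv_cancel_right]
    -- If all translations normalised `P`, then `P` would fix every point.
    · intro htop
      obtain ⟨p, hp, hp1⟩ := hPne
      refine hp1 (Subtype.ext (Equiv.ext fun x => ?_))
      have hx : x ∈ (Subgroup.normalizer (P : Set H)).comap ρ := htop ▸ Subgroup.mem_top x
      rw [Subgroup.mem_comap, Subgroup.mem_normalizer_iff''] at hx
      exact (hconjP x p).1 ((hx p).1 hp)
    · intro x hx
      have hx' : ∃ p ∈ P, (p : Equiv.Perm α) x ≠ x := by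
        by_contra! hcon
        apply hx
        have : x⁻¹ ∈ (Subgroup.normalizer (P : Set H)).comap ρ := by
          refine Subgroup.mem_normalizer_fintype fun p hp => ?_
          have := (hconjP x p).2 (hcon p hp)
          rwa [map_inv, inv_inv]
        rwa [Subgroup.inv_mem_iff] at this
      obtain ⟨p, hp, hpx⟩ := hx'
      obtain ⟨p', hp', z, hzc, hpz⟩ := conj_mem_mul_center ρ hρ P hcompl hz
        (fun g a hg ha hga => mem_center_of_conj_mem hcoatom hc hn hg ha hga) hp (ρ x)
      obtain ⟨κ, rfl⟩ := hz hzc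
      -- Evaluate `p * ρ x = ρ x * p' * ρ κ` at `1`, which `p'` fixes.
      have hval : (p : Equiv.Perm α) x = x * κ := by
        have h1 : p * ρ x = ρ x * (p' * ρ κ) := by rw [← hpz]; group
        have h1' : p * ρ x = ρ x * (ρ κ * p') := by
          rw [h1, Subgroup.mem_center_iff.1 hzc p']
        have h2 := congrArg (fun f : H => (f : Equiv.Perm α) 1) h1'
        change (p : Equiv.Perm α) ((1 : α) * x) = ((p' : Equiv.Perm α) 1) * κ * x at h2
        rw [(hPmem p').1 hp', one_mul, one_mul] at h2
        rw [h2, mul_comm]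
      refine ⟨p, p.2, hp, κ, hzc, ?_, ?_⟩
      · rintro rfl
        rw [mul_one] at hval
        exact hpx hval
      · intro k hk
        have h1 : p * ρ k = ρ k * p := Subgroup.mem_center_iff.1 hk p
        have h2 := congrArg (fun f : H => (f : Equiv.Perm α) x) h1
        change (p : Equiv.Perm α) (x * k) = (p : Equiv.Perm α) x * k at h2
        rw [h2, hval, mul_right_comm]

/-! ### Counting invariant subsets -/

/-- Membership of a point with `g x < x` is dictated by the smaller point `g x`, so only the other
points of `C` are free. -/
theorem injOn_inter_sdiff {X : Type*} [Finite X] [LinearOrder X]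
    (g : X → X) (C : Set X) :
    Set.InjOn (fun S : Set X => S ∩ (C \ {x | g x < x}))
      {S | S ⊆ C ∧ ∀ x, x ∈ S ↔ g x ∈ S} := by
  rintro S ⟨hSC, hS⟩ T ⟨hTC, hT⟩ h
  ext x
  induction x using WellFoundedLT.induction with
  | ind x ih =>
    by_cases hxC : x ∈ C
    · by_cases hx : g x < x
      · rw [hS, hT, ih _ hx]
      · have := Set.ext_iff.1 h x
        simpa [hxC, hx] using this
    · exact iff_of_false (fun hx => hxC (hSC hx)) (fun hx => hxC (hTC hx))

theorem ncard_invariant_le_sdiff {X : Type*} [Fintype X] [LinearOrder X]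
    (g : X → X) (C : Set X) :
    {S | S ⊆ C ∧ ∀ x, x ∈ S ↔ g x ∈ S}.ncard ≤ 2 ^ (C \ {x | g x < x}).ncard := by
  classical
  rw [← Set.ncard_powerset (C \ {x | g x < x})]
  exact Set.ncard_le_ncard_of_injOn _ (fun S _ => Set.inter_subset_right)
    (injOn_inter_sdiff g C)

/-- The subsets of `C` that are invariant under `g` form an exponentially small proportion when
`g` moves many points of `C`. -/
theorem ncard_invariant_le {X : Type*} [Finite X] (g : X → X) (C : Set X) :
    ({S | S ⊆ C ∧ ∀ x, x ∈ S ↔ g x ∈ S}.ncard : ℝ) ≤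
      2 ^ C.ncard * (5 / 7) ^ (C ∩ {x | g x ≠ x}).ncard := by
  classical
  have := Fintype.ofFinite X
  -- `E` will be the descents or the ascents of `g`, whichever holds at least half of the moved
  -- points. The constant `5/7` is a rational number just above `1/√2`.
  have key : ∀ E : Set X, (C ∩ {x | g x ≠ x}).ncard ≤ 2 * (C ∩ E).ncard →
      {S | S ⊆ C ∧ ∀ x, x ∈ S ↔ g x ∈ S}.ncard ≤ 2 ^ (C \ E).ncard →
      ({S | S ⊆ C ∧ ∀ x, x ∈ S ↔ g x ∈ S}.ncard : ℝ) ≤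
      2 ^ C.ncard * (5 / 7) ^ (C ∩ {x | g x ≠ x}).ncard := by
    intro E h1 h2
    calc ({S | S ⊆ C ∧ ∀ x, x ∈ S ↔ g x ∈ S}.ncard : ℝ) ≤ 2 ^ (C \ E).ncard := by
          exact_mod_cast h2
      _ = 2 ^ C.ncard * (1 / 2) ^ (C ∩ E).ncard := by
          rw [← Set.ncard_inter_add_ncard_sdiff_eq_ncard C E, pow_add, one_div, inv_pow]
          field_simp
      _ ≤ 2 ^ C.ncard * ((5 / 7) ^ 2) ^ (C ∩ E).ncard := by
          gcongr
          norm_num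
      _ ≤ _ := by
          rw [← pow_mul]
          gcongr 2 ^ _ * ?_
          exact pow_le_pow_of_le_one (by norm_num) (by norm_num) h1
  let e := Fintype.equivFin X
  let i₁ : LinearOrder X := LinearOrder.lift' e e.injective
  have hsum : (C ∩ {x | g x ≠ x}).ncard ≤
      (C ∩ {x | g x < x}).ncard + (C ∩ {x | x < g x}).ncard := by
    refine le_trans (Set.ncard_le_ncard ?_) (Set.ncard_union_le _ _)
    rintro x ⟨hx, hgx⟩
    rcases lt_or_gt_of_ne hgx with h | h
    · exact Or.inl ⟨hx, h⟩
    · exact Or.inr ⟨hx, h⟩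
  rcases le_total (C ∩ {x | g x < x}).ncard (C ∩ {x | x < g x}).ncard with h | h
  · exact key {x | x < g x} (by omega)
      -- Ascents are descents for the dual order.
      (@ncard_invariant_le_sdiff X _ (@OrderDual.instLinearOrder X i₁) g C)
  · exact key {x | g x < x} (by omega) (ncard_invariant_le_sdiff g C)

/-- The base of the exponential decay. -/
noncomputable def decay : ℝ := 1 - 1 / 2 ^ 20

theorem decay_pos : 0 < decay := by norm_num [decay]

theorem decay_lt_one : decay < 1 := by norm_num [decay]

theorem mul_pow_le_pow {j : ℕ} (hj : 16 ≤ j) : (j : ℝ) * (5 / 7) ^ j ≤ (9 / 10) ^ j := by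
  induction j, hj using Nat.le_induction with
  | base => norm_num
  | succ j hj ih =>
    have hj' : (16 : ℝ) ≤ j := by exact_mod_cast hj
    have hp : (0 : ℝ) < (5 / 7) ^ j := by positivity
    have : ((j + 1 : ℕ) : ℝ) * (5 / 7) ≤ j * (9 / 10) := by push_cast; linarith
    calc ((j + 1 : ℕ) : ℝ) * (5 / 7) ^ (j + 1) = ((j + 1 : ℕ) : ℝ) * (5 / 7) * (5 / 7) ^ j := by
          ring
      _ ≤ j * (9 / 10) * (5 / 7) ^ j := by gcongr
      _ = (j * (5 / 7) ^ j) * (9 / 10) := by ring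
      _ ≤ (9 / 10) ^ j * (9 / 10) := by gcongr
      _ = _ := by ring

/-- The bound for one coset. For large `K`, a union bound over `κ` suffices. For small `K`, it is
enough that one subset, `{1}`, is excluded, which is why `decay` is so close to `1`. -/
theorem ncard_translation_invariant_le (K : Type*) [Group K] [Finite K] :
    ({T : Set K | T = ∅ ∨ ∃ κ : K, κ ≠ 1 ∧ ∀ k, k ∈ T ↔ k * κ ∈ T}.ncard : ℝ) ≤
      (2 * decay) ^ Nat.card K := by
  classical
  set F := {T : Set K | T = ∅ ∨ ∃ κ : K, κ ≠ 1 ∧ ∀ k, k ∈ T ↔ k * κ ∈ T} with hF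
  have := Fintype.ofFinite K
  set j := Nat.card K with hj
  rw [mul_pow]
  rcases le_or_gt 16 j with h16 | h16
  · have hsub : F ⊆ ⋃ κ ∈ (Finset.univ : Finset K),
        -- The index `κ = 1` carries the empty set, so the union runs over all of `K`.
        {T | (κ = 1 → T = ∅) ∧ (∀ k, k ∈ T ↔ k * κ ∈ T)} := by
      rintro T (rfl | ⟨κ, hκ, hT⟩)
      · simp
      · simp only [Finset.mem_univ, Set.iUnion_true, Set.mem_iUnion]
        exact ⟨κ, fun h => absurd h hκ, hT⟩
    have hone : ∀ κ : K, ({T : Set K | (κ = 1 → T = ∅) ∧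
        (∀ k, k ∈ T ↔ k * κ ∈ T)}.ncard : ℝ) ≤ 2 ^ j * (5 / 7) ^ j := by
      intro κ
      by_cases hκ : κ = 1
      · have : {T : Set K | (κ = 1 → T = ∅) ∧ (∀ k, k ∈ T ↔ k * κ ∈ T)} ⊆ {∅} :=
          fun T hT => hT.1 hκ
        have h1 := Set.ncard_le_ncard this
        rw [Set.ncard_singleton] at h1
        rw [← mul_pow]
        exact le_trans (by exact_mod_cast h1) (one_le_pow₀ (by norm_num))
      · have h1 := ncard_invariant_le (fun k : K => k * κ) Set.univ
        have h2 : (Set.univ ∩ {x : K | x * κ ≠ x}).ncard = j := by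
          rw [hj, ← Set.ncard_univ]
          congr 1
          ext x
          simp [hκ]
        rw [h2, Set.ncard_univ] at h1
        refine le_trans ?_ h1
        exact_mod_cast Set.ncard_le_ncard
          (show {T : Set K | (κ = 1 → T = ∅) ∧ (∀ k, k ∈ T ↔ k * κ ∈ T)} ⊆
            {T | T ⊆ Set.univ ∧ ∀ k, k ∈ T ↔ k * κ ∈ T} from
            fun T hT => ⟨Set.subset_univ _, hT.2⟩)
    calc (F.ncard : ℝ) ≤ ∑ κ : K, (2 ^ j * (5 / 7) ^ j : ℝ) := by
          refine le_trans ?_ (Finset.sum_le_sum fun κ _ => hone κ)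
          exact_mod_cast (Set.ncard_le_ncard hsub).trans (Finset.set_ncard_biUnion_le _ _)
      _ = 2 ^ j * (j * (5 / 7) ^ j) := by
          rw [Finset.sum_const, Finset.card_univ, nsmul_eq_mul, ← Nat.card_eq_fintype_card]
          ring
      _ ≤ 2 ^ j * (9 / 10) ^ j := by
          gcongr
          exact mul_pow_le_pow h16
      _ ≤ 2 ^ j * decay ^ j := by
          gcongr
          norm_num [decay]
  · have hlt : F.ncard < 2 ^ j := by
      have : (Set.univ : Set (Set K)).ncard = 2 ^ j := by
        rw [← Set.powerset_univ, Set.ncard_powerset, Set.ncard_univ]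
      rw [← this]
      refine Set.ncard_lt_ncard ((Set.ssubset_univ_iff).2 fun h => ?_)
      have : ({1} : Set K) ∈ F := h ▸ Set.mem_univ _
      rcases this with h' | ⟨κ, hκ, h'⟩
      · exact Set.singleton_ne_empty _ h'
      · exact hκ (by simpa using (h' 1).1 rfl)
    have h1 : (F.ncard : ℝ) ≤ 2 ^ j - 1 := by
      have : F.ncard + 1 ≤ 2 ^ j := hlt
      have : (F.ncard : ℝ) + 1 ≤ 2 ^ j := by exact_mod_cast this
      linarith
    -- Bernoulli; the loss `2^j * j / 2^20` is at most `1` because `2^20 = 2^16 * 16`.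
    have h2 : 1 - (j : ℝ) * (1 / 2 ^ 20) ≤ decay ^ j := by
      have := one_add_mul_le_pow (a := -(1 / 2 ^ 20 : ℝ)) (by norm_num) j
      calc _ = 1 + (j : ℝ) * (-(1 / 2 ^ 20)) := by ring
        _ ≤ _ := this
        _ = _ := by rw [decay, sub_eq_add_neg]
    have h3 : (2 : ℝ) ^ j ≤ 2 ^ 16 := pow_le_pow_right₀ (by norm_num) h16.le
    have h4 : (j : ℝ) ≤ 16 := by exact_mod_cast h16.le
    have h5 : (2 : ℝ) ^ j * (j * (1 / 2 ^ 20)) ≤ 2 ^ 16 * (16 * (1 / 2 ^ 20)) := by gcongr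
    have h6 : (2 : ℝ) ^ j * (1 - j * (1 / 2 ^ 20)) ≤ 2 ^ j * decay ^ j := by gcongr
    have h7 : (2 : ℝ) ^ 16 * (16 * (1 / 2 ^ 20)) = 1 := by norm_num
    rw [h7] at h5
    rw [mul_sub, mul_one] at h6
    linarith

theorem bijective_out_mul {A : Type*} [Group A] (K : Subgroup A) :
    Function.Bijective (fun x : (A ⧸ K) × K => x.1.out * (x.2 : A)) := by
  have hmk : ∀ (q : A ⧸ K) (k : K), ((q.out * (k : A) : A) : A ⧸ K) = q := fun q k => by
    rw [QuotientGroup.mk_mul_of_mem _ k.2, QuotientGroup.out_eq']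
  constructor
  · rintro ⟨q, k⟩ ⟨q', k'⟩ h
    simp only at h
    have hq : q = q' := by rw [← hmk q k, h, hmk]
    subst hq
    rw [Prod.mk.injEq]
    exact ⟨rfl, Subtype.ext (mul_left_cancel h)⟩
  · intro x
    refine ⟨((x : A ⧸ K), ⟨(x : A ⧸ K).out⁻¹ * x, ?_⟩), mul_inv_cancel_left _ _⟩
    rw [← QuotientGroup.eq, QuotientGroup.out_eq']

/-- Subsets of `C` whose trace on each coset of `K` inside `D` is empty or invariant under some
nontrivial translation form an exponentially small proportion of all subsets of `C`. -/
theorem ncard_coset_invariant_le {A : Type*} [Group A] [Finite A] (K : Subgroup A)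
    {C D : Set A} (hDC : D ⊆ C) (hC : ∀ x, ∀ k ∈ K, x * k ∈ C ↔ x ∈ C)
    (hD : ∀ x, ∀ k ∈ K, x * k ∈ D ↔ x ∈ D) :
    ({S : Set A | S ⊆ C ∧ ∀ x ∈ D, (∀ k ∈ K, x * k ∉ S) ∨
      ∃ κ ∈ K, κ ≠ 1 ∧ ∀ k ∈ K, x * k ∈ S ↔ x * k * κ ∈ S}.ncard : ℝ) ≤
      2 ^ C.ncard * decay ^ D.ncard := by
  classical
  have := Fintype.ofFinite A
  set F := {T : Set K | T = ∅ ∨ ∃ κ : K, κ ≠ 1 ∧ ∀ k, k ∈ T ↔ k * κ ∈ T} with hF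
  let W : A ⧸ K → Finset (Set K) := fun q =>
    if q.out ∈ D then F.toFinset else if q.out ∈ C then Finset.univ else {∅}
  -- A weight per point, constant on cosets of `K`: its product over a coset bounds the choices of
  -- trace there, and its product over `A` is the claimed bound.
  let a : A → ℝ := fun x => (if x ∈ C then 2 else 1) * (if x ∈ D then decay else 1)
  have ha : ∀ x, ∀ k : K, a (x * k) = a x := fun x k => by
    simp only [a, hC x k k.2, hD x k k.2]
  have hW : ∀ q, ((W q).card : ℝ) ≤ a q.out ^ Nat.card K := by
    intro q
    by_cases h1 : q.out ∈ D
    · have h2 := hDC h1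
      simp only [W, a, h1, h2, if_true]
      rw [← Set.ncard_eq_toFinset_card']
      exact ncard_translation_invariant_le K
    · by_cases h2 : q.out ∈ C
      · simp only [W, a, h1, h2, if_true, if_false]
        rw [Finset.card_univ, Fintype.card_set, mul_one, Nat.card_eq_fintype_card]
        push_cast
        exact le_rfl
      · simp [W, a, h1, h2]
  have hprod : ∏ q : A ⧸ K, a q.out ^ Nat.card K = 2 ^ C.ncard * decay ^ D.ncard := by
    calc ∏ q : A ⧸ K, a q.out ^ Nat.card K = ∏ q : A ⧸ K, ∏ k : K, a (q.out * k) := by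
          refine Finset.prod_congr rfl fun q _ => ?_
          rw [Finset.prod_congr rfl fun k _ => ha q.out k, Finset.prod_const, Finset.card_univ,
            Nat.card_eq_fintype_card]
      _ = ∏ x : (A ⧸ K) × K, a (x.1.out * x.2) := by rw [Fintype.prod_prod_type]
      _ = ∏ x : A, a x := (bijective_out_mul K).prod_comp a
      _ = 2 ^ C.ncard * decay ^ D.ncard := by
          rw [Finset.prod_mul_distrib]
          simp only [Finset.prod_ite, Finset.prod_const, one_pow, mul_one,
            Set.ncard_eq_toFinset_card', Set.filter_mem_univ_eq_toFinset]
  let f : Set A → (A ⧸ K → Set K) := fun S q => {k | q.out * (k : A) ∈ S}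
  have hf : Function.Injective f := by
    intro S T h
    ext x
    obtain ⟨⟨q, k⟩, rfl⟩ := (bijective_out_mul K).2 x
    exact Set.ext_iff.1 (congrFun h q) k
  have hle : {S : Set A | S ⊆ C ∧ ∀ x ∈ D, (∀ k ∈ K, x * k ∉ S) ∨
      ∃ κ ∈ K, κ ≠ 1 ∧ ∀ k ∈ K, x * k ∈ S ↔ x * k * κ ∈ S}.ncard ≤
      (Fintype.piFinset W).card := by
    rw [← Set.ncard_coe_finset]
    refine Set.ncard_le_ncard_of_injOn f ?_ hf.injOn
    rintro S ⟨hSC, hS⟩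
    rw [Finset.mem_coe, Fintype.mem_piFinset]
    intro q
    by_cases h1 : q.out ∈ D
    · simp only [W, h1, if_true, Set.mem_toFinset]
      rcases hS _ h1 with h | ⟨κ, hκ, hκ1, h⟩
      · exact Or.inl (Set.eq_empty_of_forall_notMem fun k => h k k.2)
      · refine Or.inr ⟨⟨κ, hκ⟩, fun h' => hκ1 (congrArg Subtype.val h'), fun k => ?_⟩
        simpa [f, mul_assoc] using h k k.2
    · by_cases h2 : q.out ∈ C
      · simp [W, h1, h2]
      · simp only [W, h1, h2, if_false, Finset.mem_singleton]
        exact Set.eq_empty_of_forall_notMem fun k hk => h2 ((hC _ k k.2).1 (hSC hk))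
  calc _ ≤ ((Fintype.piFinset W).card : ℝ) := by exact_mod_cast hle
    _ = ∏ q, ((W q).card : ℝ) := by rw [Fintype.card_piFinset]; push_cast; rfl
    _ ≤ ∏ q : A ⧸ K, a q.out ^ Nat.card K :=
        Finset.prod_le_prod (fun _ _ => by positivity) fun q _ => hW q
    _ = _ := hprod

/-! ### Few subgroups and automorphisms -/

/-- A new generator outside the current subgroup at least doubles its order; once `H` is reached,
the tuple is padded with `1`. -/
theorem exists_closure_eq_or_le_card {G : Type*} [Group G] [Finite G] (H : Subgroup G) (r : ℕ) :
    ∃ f : Fin r → G, Subgroup.closure (Set.range f) ≤ H ∧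
      (Subgroup.closure (Set.range f) = H ∨
        2 ^ r ≤ Nat.card (Subgroup.closure (Set.range f))) := by
  induction r with
  | zero =>
    refine ⟨Fin.elim0, by simp, Or.inr ?_⟩
    rw [pow_zero]
    exact Nat.card_pos
  | succ r ih =>
    obtain ⟨f, hfH, hf⟩ := ih
    by_cases heq : Subgroup.closure (Set.range f) = H
    · have : Subgroup.closure (Set.range (Fin.cons 1 f : Fin (r + 1) → G)) = H := by
        rw [Fin.range_cons, Subgroup.closure_insert_one, heq]
      exact ⟨Fin.cons 1 f, this.le, Or.inl this⟩
    · obtain ⟨x, hxH, hx⟩ := SetLike.exists_of_lt (lt_of_le_of_ne hfH heq)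
      refine ⟨Fin.cons x f, ?_, Or.inr ?_⟩
      · rw [Fin.range_cons, Subgroup.closure_le, Set.insert_subset_iff]
        exact ⟨hxH, fun y hy => hfH (Subgroup.subset_closure hy)⟩
      · set M := Subgroup.closure (Set.range (Fin.cons x f : Fin (r + 1) → G))
        set M₀ := Subgroup.closure (Set.range f)
        have hle : M₀ ≤ M := Subgroup.closure_mono (by
          rw [Fin.range_cons]
          exact Set.subset_insert _ _)
        have hxM : x ∈ M := Subgroup.subset_closure ⟨0, rfl⟩
        obtain ⟨c, hc⟩ := Subgroup.card_dvd_of_le hle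
        have hM : 0 < Nat.card M := Nat.card_pos
        have hc2 : 2 ≤ c := by
          by_contra! hlt
          interval_cases c
          · omega
          · exact hx (Subgroup.eq_of_le_of_card_ge hle (by omega) ▸ hxM)
        rw [hc, pow_succ]
        exact Nat.mul_le_mul (hf.resolve_left heq) hc2

theorem exists_closure_range_eq {G : Type*} [Group G] [Finite G] {r : ℕ}
    (hr : Nat.card G < 2 ^ r) (H : Subgroup G) :
    ∃ f : Fin r → G, Subgroup.closure (Set.range f) = H := by
  obtain ⟨f, -, hf⟩ := exists_closure_eq_or_le_card H r
  refine ⟨f, hf.resolve_right fun h => ?_⟩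
  exact absurd (h.trans (Subgroup.card_le_card_group _)) (by omega)

theorem card_subgroup_le {G : Type*} [Group G] [Finite G] {r : ℕ} (hr : Nat.card G < 2 ^ r) :
    Nat.card (Subgroup G) ≤ Nat.card G ^ r := by
  choose f hf using exists_closure_range_eq hr
  have hinj : Function.Injective f := fun H H' h => by rw [← hf H, h, hf]
  simpa [Nat.card_fun] using Nat.card_le_card_of_injective f hinj

theorem card_mulEquiv_le {G : Type*} [Group G] [Finite G] {r : ℕ} (hr : Nat.card G < 2 ^ r) :
    Nat.card (G ≃* G) ≤ Nat.card G ^ r := by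
  obtain ⟨f, hf⟩ := exists_closure_range_eq hr (⊤ : Subgroup G)
  have hinj : Function.Injective (fun (φ : G ≃* G) (i : Fin r) => φ (f i)) := by
    intro φ ψ h
    have : φ.toMonoidHom = ψ.toMonoidHom := by
      refine MonoidHom.eq_of_eqOn_dense hf ?_
      rintro _ ⟨i, rfl⟩
      exact congrFun h i
    exact MulEquiv.ext fun x => DFunLike.congr_fun this x
  simpa [Nat.card_fun] using Nat.card_le_card_of_injective _ hinj

/-- If `L` meets `A \ B`, then `B ≤ L` would force `L = ⊤`. Multiplication by some `b ∈ B \ L` thus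
injects `(A \ B) ∩ L` into `(A \ B) \ L`. -/
theorem ncard_compl_le_two_mul_sdiff {A : Type*} [Group A] [Finite A] {B L : Subgroup A}
    (hB : B.index = 2) (hL : L ≠ ⊤) :
    (B : Set A)ᶜ.ncard ≤ 2 * ((B : Set A)ᶜ \ L).ncard := by
  rw [← Set.ncard_inter_add_ncard_sdiff_eq_ncard (B : Set A)ᶜ L, two_mul]
  refine Nat.add_le_add_right ?_ _
  rcases Set.eq_empty_or_nonempty ((B : Set A)ᶜ ∩ L) with h | ⟨c, hcB, hcL⟩
  · simp [h]
  · have hBL : ∃ b ∈ B, b ∉ L := by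
      by_contra! hcon
      refine hL ((Subgroup.eq_top_iff' L).2 fun x => ?_)
      by_cases hx : x ∈ B
      · exact hcon x hx
      · have : x * c ∈ B := (Subgroup.mul_mem_iff_of_index_two hB).2 (iff_of_false hx hcB)
        exact (L.mul_mem_cancel_right hcL).1 (hcon _ this)
    obtain ⟨b, hb, hbL⟩ := hBL
    refine Set.ncard_le_ncard_of_injOn (· * b) ?_ (mul_left_injective b).injOn
    rintro x ⟨hxB, hxL⟩
    refine ⟨fun h => hxB ((B.mul_mem_cancel_right hb).1 h), fun h => hbL ?_⟩
    exact (L.mul_mem_cancel_left hxL).1 h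

/-! ### Asymptotics -/

open Filter Topology in
-- The count is at most `exp(6 log² N)` and the decay at most `exp(c - cN/4)`. Half of `cN/4`
-- absorbs `6 log² N`; the other half absorbs `c + log(2/ε)`.
theorem exists_forall_pow_log_mul_decay_le {ε : ℝ} (hε : 0 < ε) :
    ∃ n : ℕ, ∀ N : ℕ, n ≤ N →
      2 * ((N : ℝ) ^ (Nat.log 2 N + 1)) ^ 2 * decay ^ (N / 4) ≤ ε := by
  set c : ℝ := -Real.log decay with hc
  have hc0 : 0 < c := neg_pos.2 (Real.log_neg decay_pos decay_lt_one)
  have h1 : ∀ᶠ N : ℕ in atTop, 6 * Real.log N ^ 2 ≤ c / 8 * N := by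
    have := (Real.isLittleO_pow_log_id_atTop (n := 2)).def (show 0 < c / 48 by positivity)
    filter_upwards [tendsto_natCast_atTop_atTop.eventually this] with N hN
    rw [Real.norm_of_nonneg (sq_nonneg _), id, Real.norm_of_nonneg (Nat.cast_nonneg N)] at hN
    linarith
  have h2 : ∀ᶠ N : ℕ in atTop, (Real.log (2 / ε) + c) * (8 / c) ≤ (N : ℝ) :=
    tendsto_natCast_atTop_atTop.eventually (eventually_ge_atTop _)
  obtain ⟨n, hn⟩ := eventually_atTop.1 ((h1.and h2).and (eventually_ge_atTop 3))
  refine ⟨n, fun N hN => ?_⟩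
  obtain ⟨⟨h1, h2⟩, h3⟩ := hn N hN
  have hN0 : (0 : ℝ) < N := by exact_mod_cast (by omega : 0 < N)
  have hlog1 : 1 ≤ Real.log N := by
    rw [Real.le_log_iff_exp_le hN0]
    exact Real.exp_one_lt_three.le.trans (by exact_mod_cast h3)
  have hl : (Nat.log 2 N : ℝ) * Real.log 2 ≤ Real.log N := by
    rw [← Real.log_pow]
    refine Real.log_le_log (by positivity) ?_
    exact_mod_cast Nat.pow_log_le_self 2 (by omega)
  have hr : (Nat.log 2 N : ℝ) + 1 ≤ 3 * Real.log N := by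
    have := Real.log_two_gt_d9
    have h0 : (0 : ℝ) ≤ Nat.log 2 N := Nat.cast_nonneg _
    nlinarith
  have e1 : ((N : ℝ) ^ (Nat.log 2 N + 1)) ^ 2 ≤ Real.exp (6 * Real.log N ^ 2) := by
    rw [← pow_mul, ← Real.exp_log (pow_pos hN0 ((Nat.log 2 N + 1) * 2)), Real.log_pow,
      Real.exp_le_exp]
    push_cast
    nlinarith
  have e2 : decay ^ (N / 4) ≤ Real.exp (c - c * N / 4) := by
    rw [← Real.exp_log (pow_pos decay_pos (N / 4)), Real.log_pow, Real.exp_le_exp]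
    -- Rounding in `N / 4` costs the extra `c` in the exponent.
    have h4 : (N : ℝ) ≤ 4 * ((N / 4 : ℕ) : ℝ) + 4 := by
      exact_mod_cast (by omega : N ≤ 4 * (N / 4) + 4)
    have : Real.log decay = -c := by rw [hc, neg_neg]
    rw [this]
    nlinarith
  have h2' : Real.log (2 / ε) + c ≤ c * N / 8 := by
    have := mul_le_mul_of_nonneg_left h2 (show 0 ≤ c / 8 by positivity)
    calc Real.log (2 / ε) + c = c / 8 * ((Real.log (2 / ε) + c) * (8 / c)) := by
          field_simp
      _ ≤ _ := this
      _ = _ := by ring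
  calc 2 * ((N : ℝ) ^ (Nat.log 2 N + 1)) ^ 2 * decay ^ (N / 4)
      ≤ 2 * Real.exp (6 * Real.log N ^ 2) * Real.exp (c - c * N / 4) := by
        have := decay_pos
        gcongr
    _ = 2 * Real.exp (6 * Real.log N ^ 2 + (c - c * N / 4)) := by rw [Real.exp_add, mul_assoc]
    _ ≤ 2 * Real.exp (-Real.log (2 / ε)) := by
        gcongr
        linarith
    _ = ε := by
        rw [Real.exp_neg, Real.exp_log (by positivity)]
        field_simp

/-! ### Union bound over non-DRRs -/

theorem rightRegular_le_autGroup {G : Type*} [Group G] (S : Set G) :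
    rightRegular G ≤ autGroup (cayleyDigraph S) := by
  rintro _ ⟨a, rfl⟩ u v
  change u * a * (v * a)⁻¹ ∈ S ↔ u * v⁻¹ ∈ S
  rw [mul_inv_rev, mul_assoc, mul_inv_cancel_left]

theorem mem_iff_of_mem_autGroup {G : Type*} [Group G] {S : Set G} {f : Equiv.Perm G}
    (hf : f ∈ autGroup (cayleyDigraph S)) (h1 : f 1 = 1) (x : G) : x ∈ S ↔ f x ∈ S := by
  have := hf x 1
  change f x * (f 1)⁻¹ ∈ S ↔ x * 1⁻¹ ∈ S at this
  rw [h1, inv_one, mul_one, mul_one] at this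
  exact this.symm

theorem not_isDRR_cases {A : Type*} [CommGroup A] [Finite A] (B : Subgroup A)
    (hB : B.index = 2) {S : Set A} (hSB : S ⊆ (B : Set A)ᶜ) (hS : ¬ IsDRR S) :
    (∃ φ : A ≃* A, φ ≠ 1 ∧ ∀ x, x ∈ S ↔ φ x ∈ S) ∨
    ∃ K L : Subgroup A, K ≤ L ∧ L ≠ ⊤ ∧ ∀ x ∈ (B : Set A)ᶜ \ L,
      (∀ k ∈ K ⊓ B, x * k ∉ S) ∨
      ∃ κ ∈ K ⊓ B, κ ≠ 1 ∧ ∀ k ∈ K ⊓ B, x * k ∈ S ↔ x * k * κ ∈ S := by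
  have hlt : rightRegular A < autGroup (cayleyDigraph S) :=
    lt_of_le_of_ne (rightRegular_le_autGroup S) (Ne.symm hS)
  obtain ⟨H, ⟨hH1, hH2⟩, hmin⟩ := Set.Finite.exists_minimal
    (s := {H | rightRegular A < H ∧ H ≤ autGroup (cayleyDigraph S)})
    (Set.toFinite _) ⟨_, hlt, le_rfl⟩
  rcases exists_automorphism_or_central_subgroup hH1
    (fun H' h1 h2 => le_antisymm h2 (hmin ⟨h1, h2.trans hH2⟩ h2)) with
    ⟨φ, hφ, hφH⟩ | ⟨K, L, hKL, hL, h⟩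
  · exact Or.inl ⟨φ, hφ, mem_iff_of_mem_autGroup (hH2 hφH) (map_one φ)⟩
  · refine Or.inr ⟨K, L, hKL, hL, fun x hx => ?_⟩
    obtain ⟨p, hp, hp1, κ, hκ, hκ1, hpk⟩ := h x hx.2
    have hinv : ∀ k ∈ K ⊓ B, x * k ∈ S ↔ x * k * κ ∈ S := fun k hk => by
      rw [mem_iff_of_mem_autGroup (hH2 hp) hp1, hpk k hk.1]
    by_cases hκB : κ ∈ B
    · exact Or.inr ⟨κ, ⟨hκ, hκB⟩, hκ1, hinv⟩
    -- A translation by `κ ∉ B` would carry a point of `S` into `B`, so the trace of `S` on this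
    -- coset of `K ⊓ B` is empty.
    · refine Or.inl fun k hk hS' => hSB ((hinv k hk).1 hS') ?_
      exact (Subgroup.mul_mem_iff_of_index_two hB).2 (iff_of_false (hSB hS') hκB)

theorem ncard_not_isDRR_le {A : Type*} [CommGroup A] [Finite A] (B : Subgroup A)
    (hB : B.index = 2) :
    ({S : Set A | S ⊆ (B : Set A)ᶜ ∧ ¬ IsDRR S}.ncard : ℝ) ≤
      2 ^ (B : Set A)ᶜ.ncard *
        (2 * ((Nat.card A : ℝ) ^ (Nat.log 2 (Nat.card A) + 1)) ^ 2 *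
          decay ^ (Nat.card A / 4)) := by
  classical
  have := Fintype.ofFinite A
  have := Fintype.ofFinite (A ≃* A)
  have := Fintype.ofFinite (Subgroup A)
  set C := (B : Set A)ᶜ with hC
  set N := Nat.card A with hN
  set r := Nat.log 2 N + 1 with hr
  have hNr : N < 2 ^ r := Nat.lt_pow_succ_log_self (by norm_num) N
  have hN0 : 0 < N := Nat.card_pos
  set X : ℝ := 2 ^ C.ncard * decay ^ (N / 4) with hX
  have hX0 : 0 ≤ X := by have := decay_pos; positivity
  have hCN : 2 * C.ncard = N := by
    have h1 := B.card_mul_index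
    rw [hB] at h1
    have h2 := Set.ncard_add_ncard_compl (B : Set A)
    rw [show (B : Set A).ncard = Nat.card B from rfl, ← hC] at h2
    omega
  have hsdiff : ∀ L : Subgroup A, L ≠ ⊤ →
      2 ^ C.ncard * decay ^ (C \ L).ncard ≤ X := by
    intro L hL
    have h1 := ncard_compl_le_two_mul_sdiff hB hL
    rw [← hC] at h1
    have h2 : N / 4 ≤ (C \ L).ncard := by omega
    rw [hX]
    gcongr 2 ^ _ * ?_
    exact pow_le_pow_of_le_one decay_pos.le decay_lt_one.le h2
  -- The side conditions sit inside the sets, so that the unions run over whole finite types and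
  -- inadmissible indices contribute nothing.
  let U : (A ≃* A) → Set (Set A) := fun φ => {S | φ ≠ 1 ∧ S ⊆ C ∧ ∀ x, x ∈ S ↔ φ x ∈ S}
  let V : Subgroup A × Subgroup A → Set (Set A) := fun KL =>
    {S | (KL.1 ≤ KL.2 ∧ KL.2 ≠ ⊤) ∧ S ⊆ C ∧ ∀ x ∈ C \ KL.2, (∀ k ∈ KL.1 ⊓ B, x * k ∉ S) ∨
      ∃ κ ∈ KL.1 ⊓ B, κ ≠ 1 ∧ ∀ k ∈ KL.1 ⊓ B, x * k ∈ S ↔ x * k * κ ∈ S}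
  have hU : ∀ φ, ((U φ).ncard : ℝ) ≤ X := by
    intro φ
    by_cases hφ : φ = 1
    · simp [U, hφ, hX0]
    -- The fixed points of a nontrivial automorphism form a proper subgroup.
    · let L : Subgroup A := φ.toMonoidHom.eqLocus (MonoidHom.id A)
      have hL : L ≠ ⊤ := by
        intro h
        refine hφ (MulEquiv.ext fun x => ?_)
        have : x ∈ L := h ▸ Subgroup.mem_top x
        exact this
      have hCL : C ∩ {x | φ x ≠ x} = C \ L := rfl
      have h1 := ncard_invariant_le φ C
      rw [hCL] at h1
      have h2 : ((U φ).ncard : ℝ) ≤ {S | S ⊆ C ∧ ∀ x, x ∈ S ↔ φ x ∈ S}.ncard := by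
        have : U φ ⊆ {S | S ⊆ C ∧ ∀ x, x ∈ S ↔ φ x ∈ S} := fun S hS => hS.2
        exact_mod_cast Set.ncard_le_ncard this
      refine h2.trans (h1.trans (le_trans ?_ (hsdiff L hL)))
      gcongr
      norm_num [decay]
  have hV : ∀ KL, ((V KL).ncard : ℝ) ≤ X := by
    rintro ⟨K, L⟩
    by_cases hKL : K ≤ L ∧ L ≠ ⊤
    -- Since `K ≤ L`, both `C` and `C \ L` are unions of cosets of `K ⊓ B`.
    · have hCk : ∀ x, ∀ k ∈ K ⊓ B, x * k ∈ C ↔ x ∈ C := fun x k hk =>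
        not_congr (B.mul_mem_cancel_right hk.2)
      have h1 := ncard_coset_invariant_le (K ⊓ B) (C := C) (D := C \ L) Set.sdiff_subset hCk
        (fun x k hk => and_congr (hCk x k hk)
          (not_congr (L.mul_mem_cancel_right (hKL.1 hk.1))))
      refine le_trans (Nat.cast_le.2 (Set.ncard_le_ncard ?_)) (h1.trans (hsdiff L hKL.2))
      exact fun S hS => hS.2
    · simp only [V, hKL, false_and, Set.ofPred_false, Set.ncard_empty, Nat.cast_zero]
      exact hX0
  have hsub : {S : Set A | S ⊆ C ∧ ¬ IsDRR S} ⊆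
      (⋃ φ ∈ (Finset.univ : Finset (A ≃* A)), U φ) ∪
        ⋃ KL ∈ (Finset.univ : Finset (Subgroup A × Subgroup A)), V KL := by
    rintro S ⟨hSC, hS⟩
    rcases not_isDRR_cases B hB hSC hS with ⟨φ, hφ, h⟩ | ⟨K, L, hKL, hL, h⟩
    · exact Or.inl (Set.mem_biUnion (Finset.mem_coe.2 (Finset.mem_univ φ)) ⟨hφ, hSC, h⟩)
    · exact Or.inr (Set.mem_biUnion (Finset.mem_coe.2 (Finset.mem_univ (K, L)))
        ⟨⟨hKL, hL⟩, hSC, h⟩)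
  have hcard : {S : Set A | S ⊆ C ∧ ¬ IsDRR S}.ncard ≤
      ∑ φ, (U φ).ncard + ∑ KL, (V KL).ncard :=
    (Set.ncard_le_ncard hsub).trans ((Set.ncard_union_le _ _).trans
      (Nat.add_le_add (Finset.set_ncard_biUnion_le _ _) (Finset.set_ncard_biUnion_le _ _)))
  have hφcard : (Fintype.card (A ≃* A) : ℝ) ≤ (N : ℝ) ^ r := by
    rw [Fintype.card_eq_nat_card]
    exact_mod_cast card_mulEquiv_le hNr
  have hscard : (Fintype.card (Subgroup A) : ℝ) ≤ (N : ℝ) ^ r := by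
    rw [Fintype.card_eq_nat_card]
    exact_mod_cast card_subgroup_le hNr
  have hone : (1 : ℝ) ≤ (N : ℝ) ^ r := one_le_pow₀ (by exact_mod_cast hN0)
  calc ({S : Set A | S ⊆ C ∧ ¬ IsDRR S}.ncard : ℝ)
      ≤ ∑ φ, ((U φ).ncard : ℝ) + ∑ KL, ((V KL).ncard : ℝ) := by exact_mod_cast hcard
    _ ≤ ∑ _φ : A ≃* A, X + ∑ _KL : Subgroup A × Subgroup A, X :=
        add_le_add (Finset.sum_le_sum fun φ _ => hU φ) (Finset.sum_le_sum fun KL _ => hV KL)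
    _ = (Fintype.card (A ≃* A) + Fintype.card (Subgroup A) * Fintype.card (Subgroup A)) * X := by
        rw [Finset.sum_const, Finset.sum_const, Finset.card_univ, Finset.card_univ,
          Fintype.card_prod, nsmul_eq_mul, nsmul_eq_mul]
        push_cast
        ring
    _ ≤ ((N : ℝ) ^ r * (N : ℝ) ^ r + (N : ℝ) ^ r * (N : ℝ) ^ r) * X := by
        gcongr
        exact hφcard.trans (le_mul_of_one_le_left (by positivity) hone)
    _ = _ := by
        rw [hX]
        ring

end CayleyDRR

theorem corollary1p2 (ε : ℝ) (hε : 0 < ε) :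
    ∃ n : ℕ, ∀ (A : Type*) [CommGroup A] [Finite A], n ≤ Nat.card A →
      ∀ B : Subgroup A, B.index = 2 →
        (Set.ncard {S : Set A | S ⊆ (B : Set A)ᶜ ∧ CayleyDRR.IsDRR S} : ℝ) /
          (Set.ncard {S : Set A | S ⊆ (B : Set A)ᶜ} : ℝ) ≥ 1 - ε := by
  obtain ⟨n, hn⟩ := CayleyDRR.exists_forall_pow_log_mul_decay_le hε
  refine ⟨n, fun A _ _ hA B hB => ?_⟩
  have hbad := CayleyDRR.ncard_not_isDRR_le B hB
  have htot : {S : Set A | S ⊆ (B : Set A)ᶜ}.ncard = 2 ^ (B : Set A)ᶜ.ncard :=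
    Set.ncard_powerset _
  have hsplit := Set.ncard_inter_add_ncard_sdiff_eq_ncard {S : Set A | S ⊆ (B : Set A)ᶜ}
    {S | CayleyDRR.IsDRR S}
  change {S : Set A | S ⊆ (B : Set A)ᶜ ∧ CayleyDRR.IsDRR S}.ncard +
    {S : Set A | S ⊆ (B : Set A)ᶜ ∧ ¬ CayleyDRR.IsDRR S}.ncard = _ at hsplit
  have hsplit' : ({S : Set A | S ⊆ (B : Set A)ᶜ ∧ CayleyDRR.IsDRR S}.ncard : ℝ) +
      {S : Set A | S ⊆ (B : Set A)ᶜ ∧ ¬ CayleyDRR.IsDRR S}.ncard =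
      2 ^ (B : Set A)ᶜ.ncard := by
    rw [htot] at hsplit
    exact_mod_cast hsplit
  have hpos : (0 : ℝ) < 2 ^ (B : Set A)ᶜ.ncard := by positivity
  rw [htot, ge_iff_le]
  push_cast
  rw [le_div_iff₀ hpos]
  have := mul_le_mul_of_nonneg_left (hn _ hA) hpos.le
  linarith
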